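/- Let $(X,Y)$ be a pair of random vectors with values in $\mathbb{R}^{d_X}\times\mathbb{R}^{d_Y}$ and arbitrary joint law, and let $(x_j,y_j)_{j\ge 1}$ be i.i.d. with the same joint law as $(X,Y)$. For $\gamma=(\alpha,\beta)\in\mathbb{R}^{d_X}\times\mathbb{R}^{d_Y}$, with Euclidean norm $\|\gamma\|=(\|\alpha\|^2+\|\beta\|^2)^{1/2}$, put $$\Delta(\gamma)=\mathbb{E}\,e^{i(\alpha^TX+\beta^TY)}-\mathbb{E}\,e^{i\alpha^TX}\;\mathbb{E}\,e^{i\beta^TY},\qquad \kappa(X,Y)=\sup_{\gamma\in\mathbb{R}^{d_X+d_Y}}|\Delta(\gamma)|,$$ $$\Delta_n(\gamma)=\frac1n\sum_{j=1}^n e^{i(\alpha^Tx_j+\beta^Ty_j)}-\Big(\frac1n\sum_{j=1}^n e^{i\alpha^Tx_j}\Big)\Big(\frac1n\sum_{j=1}^n e^{i\beta^Ty_j}\Big).$$ Let $(T_n)$ be a sequence of real numbers with $T_n\to\infty$ and $\lim_{n\to\infty}\frac{\log T_n}{n}=0$. Then, almost surely, $$\lim_{n\to\infty}\Big|\,\kappa(X,Y)-\sup_{\|\gamma\|<T_n}|\Delta_n(\gamma)|\,\Big|=0.$$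 -/

import Mathlib

open MeasureTheory ProbabilityTheory Filter Topology

noncomputable section

/-- The space `ℝ^{dX} × ℝ^{dY} = ℝ^{dX + dY}` of stacked vectors `γ = (α, β)`, with the Euclidean
norm `‖γ‖² = ‖α‖² + ‖β‖²` and the inner product `⟪α, α'⟫ + ⟪β, β'⟫`. -/
abbrev PairSpace (dX dY : ℕ) : Type :=
  WithLp 2 (EuclideanSpace ℝ (Fin dX) × EuclideanSpace ℝ (Fin dY))

/-- The empirical characteristic function `t ↦ (1/n) ∑_{j < n} exp (i ⟪z_j, t⟫)` of the first `n`
observations of the sequence `z`. -/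
def empCharFun {E : Type*} [NormedAddCommGroup E] [InnerProductSpace ℝ E]
    (z : ℕ → E) (n : ℕ) (t : E) : ℂ :=
  (1 / (n : ℂ)) * ∑ j ∈ Finset.range n, Complex.exp ((inner ℝ (z j) t : ℝ) * Complex.I)

/-- `Δ(α, β) = φ_{X,Y}(α, β) - φ_X(α) φ_Y(β)`, with the characteristic functions of the laws of
`(X, Y)`, `X` and `Y`. -/
def cfDelta {Ω : Type*} [MeasurableSpace Ω] {dX dY : ℕ} (P : Measure Ω)
    (X : Ω → EuclideanSpace ℝ (Fin dX)) (Y : Ω → EuclideanSpace ℝ (Fin dY))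
    (γ : PairSpace dX dY) : ℂ :=
  charFun (P.map (fun ω => (WithLp.toLp 2 (X ω, Y ω) : PairSpace dX dY))) γ
    - charFun (P.map X) γ.fst * charFun (P.map Y) γ.snd

/-- `Δ_n(α, β) = φ_n(α, β) - φ_n(α) φ_n(β)`, from the first `n` observations `(x_j, y_j)`. -/
def empDelta {dX dY : ℕ} (x : ℕ → EuclideanSpace ℝ (Fin dX)) (y : ℕ → EuclideanSpace ℝ (Fin dY))
    (n : ℕ) (γ : PairSpace dX dY) : ℂ :=
  empCharFun (fun j => (WithLp.toLp 2 (x j, y j) : PairSpace dX dY)) n γ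
    - empCharFun x n γ.fst * empCharFun y n γ.snd

/-- `‖f‖_∞ = sup_t |f t|`. It is used for bounded `f` only. -/
def supNorm {E : Type*} (f : E → ℂ) : ℝ :=
  ⨆ t : E, ‖f t‖

/-- `‖f‖_∞^T = sup_{‖t‖ < T} |f t|`. It is used for bounded `f` only. -/
def supNormBall {E : Type*} [Norm E] (f : E → ℂ) (T : ℝ) : ℝ :=
  ⨆ t : {t : E // ‖t‖ < T}, ‖f t‖

/-- The Kac independence measure `κ(X, Y) = ‖Δ‖_∞`. -/
def kacIM {Ω : Type*} [MeasurableSpace Ω] {dX dY : ℕ} (P : Measure Ω)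
    (X : Ω → EuclideanSpace ℝ (Fin dX)) (Y : Ω → EuclideanSpace ℝ (Fin dY)) : ℝ :=
  supNorm (cfDelta P X Y)

end

/-! The core is a uniform law of large numbers for the joint empirical characteristic function on
balls of radius `T n`. At a fixed frequency, Hoeffding bounds the deviation probability by `4 * exp
(-n ε² / 2)`. A net of fixed mesh in the ball has at most `m ^ ⌈n r⌉` points for large `n`, with `r`
as small as desired, because `log (T n) = o(n)`. The union bound is therefore summable, and
Borel–Cantelli controls the whole net.

Between net points no moments are available, so the law is truncated at a radius `R`: each
exponential is `R`-Lipschitz in the frequency when `‖z‖ ≤ R`, and the strong law bounds the fraction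
of observations beyond `R`.

The marginal functions are the joint one at `(α, 0)` and `(0, β)`, which lie in the same ball as
`(α, β)`. So the one law gives uniform convergence of `Δ_n` to `Δ`, and the suprema follow. -/

/-! ### Truncated Lipschitz estimates in the frequency. -/

/-- For `‖z‖ ≤ R` this is `|exp (i u) - 1| ≤ |u|` with Cauchy–Schwarz; beyond `R` the trivial bound
2 is used. Averaging over a sample or a law then costs only a tail frequency or probability. -/
lemma norm_exp_inner_sub_le {E : Type*} [NormedAddCommGroup E] [InnerProductSpace ℝ E]
    {R : ℝ} (hR : 0 ≤ R) (z s t : E) :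
    ‖Complex.exp ((inner ℝ z s : ℝ) * Complex.I) - Complex.exp ((inner ℝ z t : ℝ) * Complex.I)‖
      ≤ R * ‖s - t‖ + 2 * Set.indicator {z : E | R < ‖z‖} 1 z := by
  by_cases hz : R < ‖z‖
  · have h : Set.indicator {z : E | R < ‖z‖} (1 : E → ℝ) z = 1 := by simp [hz]
    rw [h]
    refine (norm_sub_le _ _).trans ?_
    rw [Complex.norm_exp_ofReal_mul_I, Complex.norm_exp_ofReal_mul_I]
    have : 0 ≤ R * ‖s - t‖ := by positivity
    linarith
  · have h : Set.indicator {z : E | R < ‖z‖} (1 : E → ℝ) z = 0 := by simp [hz]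
    rw [h, mul_zero, add_zero]
    have hfac : Complex.exp ((inner ℝ z s : ℝ) * Complex.I)
          - Complex.exp ((inner ℝ z t : ℝ) * Complex.I)
        = Complex.exp ((inner ℝ z t : ℝ) * Complex.I)
          * (Complex.exp (Complex.I * (inner ℝ z (s - t) : ℝ)) - 1) := by
      rw [mul_sub, mul_one, ← Complex.exp_add, inner_sub_right]
      push_cast
      ring_nf
    rw [hfac, norm_mul, Complex.norm_exp_ofReal_mul_I, one_mul]
    refine Real.norm_exp_I_mul_ofReal_sub_one_le.trans ((norm_inner_le_norm _ _).trans ?_)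
    exact mul_le_mul_of_nonneg_right (not_lt.mp hz) (norm_nonneg _)

lemma norm_empCharFun_le_one {E : Type*} [NormedAddCommGroup E] [InnerProductSpace ℝ E]
    (z : ℕ → E) (n : ℕ) (t : E) : ‖empCharFun z n t‖ ≤ 1 := by
  unfold empCharFun
  rw [norm_mul, norm_div, norm_one, Complex.norm_natCast]
  have h : ‖∑ j ∈ Finset.range n, Complex.exp ((inner ℝ (z j) t : ℝ) * Complex.I)‖ ≤ n := by
    refine (norm_sum_le _ _).trans ?_
    simp [Complex.norm_exp_ofReal_mul_I]
  calc 1 / (n : ℝ) * _ ≤ 1 / (n : ℝ) * n := by gcongr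
    _ ≤ 1 := by rw [one_div, inv_mul_eq_div]; exact div_self_le_one _

lemma norm_empCharFun_sub_le {E : Type*} [NormedAddCommGroup E] [InnerProductSpace ℝ E]
    {R : ℝ} (hR : 0 ≤ R) (z : ℕ → E) (n : ℕ) (s t : E) :
    ‖empCharFun z n s - empCharFun z n t‖ ≤ R * ‖s - t‖
      + 2 * ((∑ j ∈ Finset.range n, Set.indicator {z : E | R < ‖z‖} 1 (z j)) / n) := by
  unfold empCharFun
  rw [← mul_sub, ← Finset.sum_sub_distrib, norm_mul, norm_div, norm_one, Complex.norm_natCast]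
  have h : ‖∑ j ∈ Finset.range n, (Complex.exp ((inner ℝ (z j) s : ℝ) * Complex.I)
      - Complex.exp ((inner ℝ (z j) t : ℝ) * Complex.I))‖ ≤ n * (R * ‖s - t‖)
        + 2 * ∑ j ∈ Finset.range n, Set.indicator {z : E | R < ‖z‖} 1 (z j) := by
    refine (norm_sum_le _ _).trans
      ((Finset.sum_le_sum fun j _ => norm_exp_inner_sub_le hR (z j) s t).trans_eq ?_)
    rw [Finset.sum_add_distrib, Finset.mul_sum]
    simp
  rcases Nat.eq_zero_or_pos n with rfl | hn
  -- For `n = 0`, division by zero makes the left side and the tail fraction vanish.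
  · simp only [CharP.cast_eq_zero, div_zero, zero_mul, mul_zero, add_zero]
    positivity
  · have hn' : (0 : ℝ) < n := by exact_mod_cast hn
    refine (mul_le_mul_of_nonneg_left h (by positivity)).trans_eq ?_
    field_simp

section Charfun

variable {E : Type*} [NormedAddCommGroup E] [InnerProductSpace ℝ E]
  [SecondCountableTopology E] [MeasurableSpace E] [BorelSpace E]

lemma integrable_exp_inner_mul_I (ν : Measure E) [IsFiniteMeasure ν] (t : E) :
    Integrable (fun z : E => Complex.exp ((inner ℝ z t : ℝ) * Complex.I)) ν := by
  refine Integrable.of_bound (C := 1) (Measurable.aestronglyMeasurable (by fun_prop)) ?_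
  exact ae_of_all _ fun z => (Complex.norm_exp_ofReal_mul_I _).le

lemma norm_charFun_sub_le {R : ℝ} (hR : 0 ≤ R) (ν : Measure E) [IsProbabilityMeasure ν]
    (s t : E) :
    ‖charFun ν s - charFun ν t‖ ≤ R * ‖s - t‖ + 2 * ν.real {z : E | R < ‖z‖} := by
  have hmeas : MeasurableSet {z : E | R < ‖z‖} := measurableSet_lt measurable_const measurable_norm
  have hint : Integrable (Set.indicator {z : E | R < ‖z‖} (1 : E → ℝ)) ν :=
    (integrable_const (1 : ℝ)).indicator hmeas
  rw [charFun_apply, charFun_apply,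
    ← integral_sub (integrable_exp_inner_mul_I ν s) (integrable_exp_inner_mul_I ν t)]
  refine (norm_integral_le_of_norm_le ((integrable_const (R * ‖s - t‖)).add (hint.const_mul 2))
    (ae_of_all _ fun z => norm_exp_inner_sub_le hR z s t)).trans_eq ?_
  simp only [Pi.add_apply]
  rw [integral_add (integrable_const _) (hint.const_mul 2), integral_const,
    integral_const_mul (2 : ℝ), integral_indicator_one hmeas]
  simp

end Charfun

/-! ### Concentration at a fixed frequency. -/

section Hoeffding

variable {Ω : Type*} [MeasurableSpace Ω] {μ : Measure Ω} [IsProbabilityMeasure μ]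

/-- One-sided Hoeffding bound for the empirical mean of a function with values in `[-1, 1]`. -/
lemma measureReal_le_mean_sub_integral_le {E : Type*} [MeasurableSpace E] {Z : ℕ → Ω → E}
    {ν : Measure E} (hindep : iIndepFun Z μ) (hZ : ∀ j, AEMeasurable (Z j) μ)
    (hlaw : ∀ j, μ.map (Z j) = ν) {f : E → ℝ} (hf : Measurable f) (hf1 : ∀ z, |f z| ≤ 1)
    {ε : ℝ} (hε : 0 ≤ ε) {n : ℕ} (hn : 0 < n) :
    μ.real {ω | ε ≤ (1 / (n : ℝ)) * ∑ j ∈ Finset.range n, f (Z j ω) - ∫ z, f z ∂ν}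
      ≤ Real.exp (-(n * ε ^ 2 / 2)) := by
  have hn' : (0 : ℝ) < n := by exact_mod_cast hn
  have hmean : ∀ j, ∫ ω, f (Z j ω) ∂μ = ∫ z, f z ∂ν := fun j => by
    rw [← hlaw j, integral_map (hZ j) hf.aestronglyMeasurable]
  have hind : iIndepFun (fun j ω => f (Z j ω) - ∫ z, f z ∂ν) μ :=
    hindep.comp (fun _ z => f z - ∫ z, f z ∂ν) (fun _ => hf.sub_const _)
  have hsub : ∀ j < n, HasSubgaussianMGF (fun ω => f (Z j ω) - ∫ z, f z ∂ν) 1 μ := fun j _ => by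
    have h := hasSubgaussianMGF_of_mem_Icc (μ := μ) (a := -1) (b := 1)
      (hf.comp_aemeasurable (hZ j)) (ae_of_all _ fun ω => abs_le.mp (hf1 (Z j ω)))
    -- Hoeffding's lemma on `[a, b]` has variance proxy `((b - a) / 2) ^ 2`.
    have hc : (‖(1 : ℝ) - -1‖₊ / 2) ^ 2 = 1 := by
      rw [← NNReal.coe_inj]
      norm_num
    rw [hc] at h
    simpa only [Function.comp_apply, hmean j] using h
  have h := HasSubgaussianMGF.measure_sum_range_ge_le_of_iIndepFun hind hsub
    (ε := n * ε) (by positivity)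
  have hexp : -(n * ε) ^ 2 / (2 * n * ((1 : NNReal) : ℝ)) = -(n * ε ^ 2 / 2) := by
    rw [NNReal.coe_one]
    field_simp
  rw [hexp] at h
  refine le_trans (measureReal_mono fun ω hω => ?_) h
  simp only [Set.mem_ofPred_eq] at hω ⊢
  rw [Finset.sum_sub_distrib, Finset.sum_const, Finset.card_range, nsmul_eq_mul]
  have h1 := mul_le_mul_of_nonneg_left hω hn'.le
  rw [mul_sub, ← mul_assoc, mul_one_div_cancel hn'.ne', one_mul] at h1
  exact h1

/-- Two-sided Hoeffding bound for the empirical mean of a function with values in `[-1, 1]`. -/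
lemma measureReal_le_abs_mean_sub_integral_le {E : Type*} [MeasurableSpace E] {Z : ℕ → Ω → E}
    {ν : Measure E} (hindep : iIndepFun Z μ) (hZ : ∀ j, AEMeasurable (Z j) μ)
    (hlaw : ∀ j, μ.map (Z j) = ν) {f : E → ℝ} (hf : Measurable f) (hf1 : ∀ z, |f z| ≤ 1)
    {ε : ℝ} (hε : 0 ≤ ε) {n : ℕ} (hn : 0 < n) :
    μ.real {ω | ε ≤ |(1 / (n : ℝ)) * ∑ j ∈ Finset.range n, f (Z j ω) - ∫ z, f z ∂ν|}
      ≤ 2 * Real.exp (-(n * ε ^ 2 / 2)) := by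
  have h1 := measureReal_le_mean_sub_integral_le hindep hZ hlaw hf hf1 hε hn
  have h2 := measureReal_le_mean_sub_integral_le hindep hZ hlaw (f := fun z => -f z) hf.neg
    (fun z => by simpa using hf1 z) hε hn
  refine (measureReal_mono (fun ω hω => ?_)).trans
    ((measureReal_union_le _ _).trans ((add_le_add h1 h2).trans_eq (by ring)))
  rcases le_abs.mp (Set.mem_ofPred_eq ▸ hω) with h | h
  · exact Or.inl h
  · refine Or.inr ?_
    simp only [Set.mem_ofPred_eq, integral_neg, Finset.sum_neg_distrib]
    linarith

/-- Since `‖w‖ ≤ |re w| + |im w|`, a deviation of `2 * ε` forces one of `ε` in the real or the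
imaginary part; each contributes two tails. -/
lemma measureReal_le_norm_empCharFun_sub_charFun_le {E : Type*} [NormedAddCommGroup E]
    [InnerProductSpace ℝ E] [SecondCountableTopology E] [MeasurableSpace E] [BorelSpace E]
    {Z : ℕ → Ω → E} {ν : Measure E} [IsProbabilityMeasure ν]
    (hindep : iIndepFun Z μ) (hZ : ∀ j, AEMeasurable (Z j) μ)
    (hlaw : ∀ j, μ.map (Z j) = ν) {ε : ℝ} (hε : 0 ≤ ε) (n : ℕ) (t : E) :
    μ.real {ω | 2 * ε ≤ ‖empCharFun (fun j => Z j ω) n t - charFun ν t‖}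
      ≤ 4 * Real.exp (-(n * ε ^ 2 / 2)) := by
  rcases Nat.eq_zero_or_pos n with rfl | hn
  -- For `n = 0` the right side is 4, which exceeds any probability.
  · refine measureReal_le_one.trans ?_
    norm_num
  set e : E → ℂ := fun z => Complex.exp ((inner ℝ z t : ℝ) * Complex.I) with he
  have hem : Measurable e := by fun_prop
  have hnorm : ∀ z, ‖e z‖ = 1 := fun z => Complex.norm_exp_ofReal_mul_I _
  have h1 := measureReal_le_abs_mean_sub_integral_le hindep hZ hlaw
    (f := fun z => (e z).re) (Complex.measurable_re.comp hem)
    (fun z => (Complex.abs_re_le_norm _).trans (hnorm z).le) hε hn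
  have h2 := measureReal_le_abs_mean_sub_integral_le hindep hZ hlaw
    (f := fun z => (e z).im) (Complex.measurable_im.comp hem)
    (fun z => (Complex.abs_im_le_norm _).trans (hnorm z).le) hε hn
  refine (measureReal_mono (fun ω hω => ?_)).trans
    ((measureReal_union_le _ _).trans ((add_le_add h1 h2).trans_eq (by ring)))
  have hre : (empCharFun (fun j => Z j ω) n t - charFun ν t).re
      = (1 / (n : ℝ)) * ∑ j ∈ Finset.range n, (e (Z j ω)).re - ∫ z, (e z).re ∂ν := by
    have hI := integral_re (integrable_exp_inner_mul_I ν t)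
    simp only [RCLike.re_eq_complex_re] at hI
    rw [Complex.sub_re, charFun_apply, ← hI, ← Complex.re_sum, ← Complex.re_ofReal_mul]
    simp [empCharFun, he]
  have him : (empCharFun (fun j => Z j ω) n t - charFun ν t).im
      = (1 / (n : ℝ)) * ∑ j ∈ Finset.range n, (e (Z j ω)).im - ∫ z, (e z).im ∂ν := by
    have hI := integral_im (integrable_exp_inner_mul_I ν t)
    simp only [RCLike.im_eq_complex_im] at hI
    rw [Complex.sub_im, charFun_apply, ← hI, ← Complex.im_sum, ← Complex.im_ofReal_mul]
    simp [empCharFun, he]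
  have hle := Complex.norm_le_abs_re_add_abs_im (empCharFun (fun j => Z j ω) n t - charFun ν t)
  rw [hre, him] at hle
  by_contra hcon
  simp only [Set.mem_union, Set.mem_ofPred_eq, not_or, not_le] at hcon hω
  linarith [hcon.1, hcon.2]

end Hoeffding

/-! ### Covering numbers, tails and growth rates. -/

/-- In a finite-dimensional space, balls of radius `2 ^ k * δ` are covered by `m ^ k` balls of
radius `δ`, with `m` depending only on the space. -/
lemma exists_card_le_pow_ball_subset {E : Type*} [NormedAddCommGroup E] [NormedSpace ℝ E]
    [ProperSpace E] :
    ∃ m : ℕ, 0 < m ∧ ∀ (k : ℕ) (δ : ℝ), 0 < δ → ∃ S : Finset E, S.card ≤ m ^ k ∧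
      Metric.ball (0 : E) (2 ^ k * δ) ⊆ ⋃ s ∈ S, Metric.ball s δ := by
  classical
  obtain ⟨A, -, hAfin, hA⟩ := finite_cover_balls_of_compact
    (isCompact_closedBall (0 : E) 1) (e := 1 / 2) (by norm_num)
  set A' := hAfin.toFinset with hA'
  have hcov : ∀ u : E, ‖u‖ ≤ 1 → ∃ a ∈ A', ‖u - a‖ < 1 / 2 := fun u hu => by
    have := hA (mem_closedBall_zero_iff.mpr hu)
    simpa [hA', dist_eq_norm] using this
  refine ⟨A'.card, ?_, fun k => ?_⟩
  · obtain ⟨a, ha, -⟩ := hcov 0 (by simp)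
    exact Finset.card_pos.mpr ⟨a, ha⟩
  · induction k with
    | zero =>
      intro δ hδ
      exact ⟨{0}, by simp, by simp⟩
    | succ k ih =>
      intro δ hδ
      -- As `2 ^ (k + 1) * δ = 2 ^ k * (2 * δ)`, the ball is covered at scale `2 * δ`; each piece is
      -- then split by a scaled copy of the half-radius cover `A'` of the unit ball.
      obtain ⟨S, hS, hSc⟩ := ih (2 * δ) (by positivity)
      refine ⟨Finset.image₂ (fun s a => s + (2 * δ) • a) S A', ?_, fun x hx => ?_⟩
      · rw [pow_succ]
        exact Finset.card_image₂_le _ _ _ |>.trans (Nat.mul_le_mul_right _ hS)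
      · have hx' := hSc (by rwa [← mul_assoc, ← pow_succ])
        simp only [Set.mem_iUnion, mem_ball_iff_norm, exists_prop] at hx' ⊢
        obtain ⟨s, hs, hxs⟩ := hx'
        have h2δ : 0 < 2 * δ := by positivity
        obtain ⟨a, ha, hxa⟩ := hcov ((2 * δ)⁻¹ • (x - s)) (by
          rw [norm_smul, Real.norm_of_nonneg (by positivity), inv_mul_le_one₀ h2δ]
          exact hxs.le)
        refine ⟨s + (2 * δ) • a, Finset.mem_image₂_of_mem hs ha, ?_⟩
        have hfac : x - (s + (2 * δ) • a) = (2 * δ) • ((2 * δ)⁻¹ • (x - s) - a) := by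
          rw [smul_sub, smul_inv_smul₀ h2δ.ne']
          abel
        rw [hfac, norm_smul, Real.norm_of_nonneg h2δ.le]
        nlinarith

lemma exists_measureReal_lt_norm_lt {E : Type*} [NormedAddCommGroup E] [MeasurableSpace E]
    [OpensMeasurableSpace E] (ν : Measure E) [IsFiniteMeasure ν] {ε : ℝ} (hε : 0 < ε) :
    ∃ R : ℝ, 0 < R ∧ ν.real {z : E | R < ‖z‖} < ε := by
  have h := tendsto_measure_iInter_atTop (μ := ν) (s := fun n : ℕ => {z : E | (n : ℝ) < ‖z‖})
    (fun n => (measurableSet_lt measurable_const measurable_norm).nullMeasurableSet)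
    (fun a b hab z (hz : (b : ℝ) < ‖z‖) => (Nat.cast_le.mpr hab).trans_lt hz) ⟨0, measure_ne_top _ _⟩
  have hempty : ⋂ n : ℕ, {z : E | (n : ℝ) < ‖z‖} = ∅ := by
    refine Set.eq_empty_of_forall_notMem fun z hz => ?_
    obtain ⟨n, hn⟩ := exists_nat_ge ‖z‖
    exact absurd (Set.mem_iInter.mp hz n) (not_lt.mpr hn)
  rw [hempty, measure_empty] at h
  have hev := (h.eventually_lt_const (ENNReal.ofReal_pos.mpr hε)).and (eventually_gt_atTop 0)
  obtain ⟨n, hn, hpos⟩ := hev.exists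
  exact ⟨n, Nat.cast_pos.mpr hpos, (ENNReal.lt_ofReal_iff_toReal_lt (measure_ne_top _ _)).mp hn⟩

lemma eventually_le_two_pow_ceil_mul {T : ℕ → ℝ} (hT : Tendsto T atTop atTop)
    (hlog : Tendsto (fun n : ℕ => Real.log (T n) / (n : ℝ)) atTop (𝓝 0))
    {r δ : ℝ} (hr : 0 < r) (hδ : 0 < δ) :
    ∀ᶠ n : ℕ in atTop, T n ≤ 2 ^ ⌈(n : ℝ) * r⌉₊ * δ := by
  -- Half of the exponential rate `r * log 2` dominates `log (T n)`; the other half absorbs `-log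
  -- δ`.
  have hc : 0 < r * Real.log 2 / 2 := by
    have := Real.log_pos (one_lt_two (α := ℝ))
    positivity
  have hlin : Tendsto (fun n : ℕ => (n : ℝ) * (r * Real.log 2 / 2)) atTop atTop :=
    tendsto_natCast_atTop_atTop.atTop_mul_const hc
  filter_upwards [hT.eventually_gt_atTop 0, hlog.eventually_lt_const hc, eventually_gt_atTop 0,
    hlin.eventually_ge_atTop (-Real.log δ)] with n hTn hn hn0 hn1
  have hn' : (0 : ℝ) < n := Nat.cast_pos.mpr hn0
  rw [div_lt_iff₀ hn'] at hn
  have hk := mul_le_mul_of_nonneg_right (Nat.le_ceil ((n : ℝ) * r))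
    (Real.log_pos (one_lt_two (α := ℝ))).le
  rw [← Real.log_le_log_iff hTn (by positivity), Real.log_mul (by positivity) hδ.ne',
    Real.log_pow]
  linarith

/-- Rounding up costs at most one factor `m`, which leaves a convergent geometric series. This is
where net size is weighed against concentration. -/
lemma summable_pow_ceil_mul_exp {m : ℕ} (hm : 0 < m) {r c : ℝ} (hr : 0 ≤ r)
    (hrc : r * Real.log m < c) :
    Summable fun n : ℕ => (m : ℝ) ^ ⌈(n : ℝ) * r⌉₊ * (4 * Real.exp (-(n * c))) := by
  have hm' : (0 : ℝ) < m := Nat.cast_pos.mpr hm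
  have hlogm : 0 ≤ Real.log m := Real.log_natCast_nonneg m
  have hsum : Summable fun n : ℕ => Real.exp (n * (r * Real.log m - c)) :=
    Real.summable_exp_nat_mul_iff.mpr (by linarith)
  refine Summable.of_nonneg_of_le (fun n => by positivity) (fun n => ?_)
    (hsum.mul_left (4 * (m : ℝ)))
  have hpow : (m : ℝ) ^ ⌈(n : ℝ) * r⌉₊ ≤ m * Real.exp (n * r * Real.log m) := by
    rw [← Real.log_le_log_iff (by positivity) (by positivity), Real.log_pow,
      Real.log_mul hm'.ne' (Real.exp_ne_zero _), Real.log_exp]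
    have := mul_le_mul_of_nonneg_right
      (Nat.ceil_lt_add_one (a := (n : ℝ) * r) (by positivity)).le hlogm
    linarith
  refine (mul_le_mul_of_nonneg_right hpow (by positivity)).trans_eq ?_
  rw [show (n : ℝ) * (r * Real.log m - c) = n * r * Real.log m + -(n * c) by ring, Real.exp_add]
  ring

/-- The fraction of the first `n` observations of norm larger than `R` is eventually smaller than
any bound on the probability of that event. -/
lemma ae_eventually_mean_indicator_lt {Ω : Type*} [MeasurableSpace Ω] {μ : Measure Ω}
    {E : Type*} [NormedAddCommGroup E] [MeasurableSpace E] [BorelSpace E] {Z : ℕ → Ω → E}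
    {ν : Measure E} [IsProbabilityMeasure ν] (hindep : iIndepFun Z μ)
    (hZ : ∀ j, AEMeasurable (Z j) μ) (hlaw : ∀ j, μ.map (Z j) = ν) {R ε : ℝ} (hR : ν.real {z : E | R < ‖z‖} < ε) :
    ∀ᵐ ω ∂μ, ∀ᶠ n : ℕ in atTop,
      (∑ j ∈ Finset.range n, Set.indicator {z : E | R < ‖z‖} (1 : E → ℝ) (Z j ω)) / n < ε := by
  have hmeas : MeasurableSet {z : E | R < ‖z‖} := measurableSet_lt measurable_const measurable_norm
  set f : E → ℝ := Set.indicator {z : E | R < ‖z‖} 1 with hf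
  have hfm : Measurable f := measurable_one.indicator hmeas
  have hint : Integrable f (μ.map (Z 0)) := by
    rw [hlaw 0]
    exact (integrable_const (1 : ℝ)).indicator hmeas
  have h := strong_law_ae_real (fun j => f ∘ Z j) (hint.comp_aemeasurable (hZ 0))
    (fun i j hij => (hindep.indepFun hij).comp hfm hfm)
    (fun i => IdentDistrib.comp ⟨hZ i, hZ 0, (hlaw i).trans (hlaw 0).symm⟩ hfm)
  have hmean : ∫ ω, (f ∘ Z 0) ω ∂μ = ν.real {z : E | R < ‖z‖} := by
    rw [← integral_indicator_one hmeas, ← hlaw 0, integral_map (hZ 0) hfm.aestronglyMeasurable]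
    rfl
  filter_upwards [h] with ω hω
  rw [hmean] at hω
  exact hω.eventually_lt_const hR

/-! ### The uniform law on growing balls. -/

section Uniform

variable {Ω : Type*} [MeasurableSpace Ω] {μ : Measure Ω} [IsProbabilityMeasure μ]
  {E : Type*} [NormedAddCommGroup E] [InnerProductSpace ℝ E] [ProperSpace E] [MeasurableSpace E]
  [BorelSpace E] {Z : ℕ → Ω → E} {ν : Measure E} [IsProbabilityMeasure ν]

lemma ae_eventually_forall_mem_ball_norm_empCharFun_sub_charFun_lt (hindep : iIndepFun Z μ)
    (hZ : ∀ j, AEMeasurable (Z j) μ) (hlaw : ∀ j, μ.map (Z j) = ν) {T : ℕ → ℝ}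
    (hT : Tendsto T atTop atTop)
    (hlog : Tendsto (fun n : ℕ => Real.log (T n) / (n : ℝ)) atTop (𝓝 0)) {ε : ℝ} (hε : 0 < ε) :
    ∀ᵐ ω ∂μ, ∀ᶠ n : ℕ in atTop, ∀ t : E, ‖t‖ < T n →
      ‖empCharFun (fun j => Z j ω) n t - charFun ν t‖ < 8 * ε := by
  obtain ⟨R, hR, hRε⟩ := exists_measureReal_lt_norm_lt ν hε
  obtain ⟨m, hm, hcover⟩ := exists_card_le_pow_ball_subset (E := E)
  have hδ : 0 < ε / R := div_pos hε hR
  have hlogm : 0 ≤ Real.log m := Real.log_natCast_nonneg m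
  -- The `+ 1` keeps the denominator positive when `m = 1`; then `r * log m ≤ ε ^ 2 / 4`, below
  -- Hoeffding's rate `ε ^ 2 / 2`.
  set r : ℝ := ε ^ 2 / (4 * (Real.log m + 1)) with hr
  have hr0 : 0 < r := by positivity
  have hrm : r * Real.log m < ε ^ 2 / 2 := by
    have hr' : r * (Real.log m + 1) = ε ^ 2 / 4 := by
      rw [hr]
      field_simp
    nlinarith [sq_pos_of_pos hε]
  choose S hScard hScov using fun n : ℕ => hcover ⌈(n : ℝ) * r⌉₊ (ε / R) hδ
  have hnet : ∀ᵐ ω ∂μ, ∀ᶠ n : ℕ in atTop, ω ∉ ⋃ s ∈ S n,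
      {ω | 2 * ε ≤ ‖empCharFun (fun j => Z j ω) n s - charFun ν s‖} := by
    -- Borel–Cantelli, with a union bound over the net.
    refine ae_eventually_notMem (ne_top_of_le_ne_top
      (summable_pow_ceil_mul_exp hm hr0.le hrm).tsum_ofReal_ne_top
      (ENNReal.tsum_le_tsum fun n => ?_))
    rw [← ofReal_measureReal (measure_ne_top _ _)]
    refine ENNReal.ofReal_le_ofReal ((measureReal_biUnion_finset_le _ _).trans
      ((Finset.sum_le_sum fun s _ =>
        measureReal_le_norm_empCharFun_sub_charFun_le hindep hZ hlaw hε.le n s).trans ?_))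
    rw [Finset.sum_const, nsmul_eq_mul, mul_div_assoc]
    refine mul_le_mul_of_nonneg_right ?_ (by positivity)
    exact_mod_cast hScard n
  filter_upwards [hnet, ae_eventually_mean_indicator_lt hindep hZ hlaw hRε] with ω hω1 hω2
  filter_upwards [hω1, hω2, eventually_le_two_pow_ceil_mul hT hlog hr0 hδ] with n h1 h2 h3 t ht
  have htS := hScov n (mem_ball_zero_iff.mpr (ht.trans_le h3))
  simp only [Set.mem_iUnion, mem_ball_iff_norm, exists_prop] at htS
  obtain ⟨s, hs, hts⟩ := htS
  simp only [Set.mem_iUnion, Set.mem_ofPred_eq, exists_prop, not_exists, not_and, not_le] at h1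
  have hRts : R * ‖t - s‖ < ε := by
    rwa [lt_div_iff₀ hR, mul_comm] at hts
  have e1 := norm_empCharFun_sub_le hR.le (fun j => Z j ω) n t s
  have e2 := norm_charFun_sub_le hR.le ν t s
  have e3 := h1 s hs
  have tri : ‖empCharFun (fun j => Z j ω) n t - charFun ν t‖
      ≤ ‖empCharFun (fun j => Z j ω) n t - empCharFun (fun j => Z j ω) n s‖
        + ‖empCharFun (fun j => Z j ω) n s - charFun ν s‖ + ‖charFun ν t - charFun ν s‖ := by
    rw [norm_sub_rev (charFun ν t)]
    refine le_trans (le_of_eq (congrArg _ ?_)) (norm_add₃_le)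
    abel
  -- The `8 * ε` is `2 * ε` at the net point plus, for each of the two functions, `ε` from the
  -- Lipschitz part and `2 * ε` from the tail.
  linarith

/-- Uniform strong law for empirical characteristic functions on balls whose radii grow
subexponentially. -/
lemma ae_forall_eventually_forall_mem_ball_norm_empCharFun_sub_charFun_lt
    (hindep : iIndepFun Z μ) (hZ : ∀ j, AEMeasurable (Z j) μ) (hlaw : ∀ j, μ.map (Z j) = ν)
    {T : ℕ → ℝ} (hT : Tendsto T atTop atTop)
    (hlog : Tendsto (fun n : ℕ => Real.log (T n) / (n : ℝ)) atTop (𝓝 0)) :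
    ∀ᵐ ω ∂μ, ∀ ε > 0, ∀ᶠ n : ℕ in atTop, ∀ t : E, ‖t‖ < T n →
      ‖empCharFun (fun j => Z j ω) n t - charFun ν t‖ < ε := by
  -- The exceptional null set depends on the tolerance, so only countably many tolerances are taken.
  have h : ∀ᵐ ω ∂μ, ∀ k : ℕ, ∀ᶠ n : ℕ in atTop, ∀ t : E, ‖t‖ < T n →
      ‖empCharFun (fun j => Z j ω) n t - charFun ν t‖ < 8 * (1 / ((k : ℝ) + 1)) :=
    ae_all_iff.mpr fun k => ae_eventually_forall_mem_ball_norm_empCharFun_sub_charFun_lt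
      hindep hZ hlaw hT hlog Nat.one_div_pos_of_nat
  filter_upwards [h] with ω hω ε hε
  obtain ⟨k, hk⟩ := exists_nat_one_div_lt (show 0 < ε / 8 by positivity)
  filter_upwards [hω k] with n hn t ht
  exact (hn t ht).trans_le (by linarith)

end Uniform

/-! ### From uniform convergence to suprema. -/

lemma bddAbove_range_norm_of_forall_le {E ι : Type*} {f : E → ℂ} {C : ℝ} (hf : ∀ t, ‖f t‖ ≤ C)
    (g : ι → E) : BddAbove (Set.range fun i => ‖f (g i)‖) :=
  ⟨C, by rintro _ ⟨i, rfl⟩; exact hf _⟩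

/-- Suprema over growing balls of functions that converge uniformly on them tend to the supremum
of the limit. -/
lemma tendsto_abs_supNorm_sub_supNormBall {E : Type*} [NormedAddCommGroup E] {f : E → ℂ}
    {g : ℕ → E → ℂ} {C : ℝ} (hf : ∀ t, ‖f t‖ ≤ C) (hg : ∀ n t, ‖g n t‖ ≤ C) {T : ℕ → ℝ}
    (hT : Tendsto T atTop atTop)
    (hfg : ∀ ε > 0, ∀ᶠ n in atTop, ∀ t, ‖t‖ < T n → ‖g n t - f t‖ < ε) :
    Tendsto (fun n => |supNorm f - supNormBall (g n) (T n)|) atTop (𝓝 0) := by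
  rw [Metric.tendsto_nhds]
  intro ε hε
  -- A near-maximiser of the limit is fixed; it enters the ball once `T n > ‖t₀‖`, which gives the
  -- lower bound.
  obtain ⟨t₀, ht₀⟩ := exists_lt_of_lt_ciSup (show supNorm f - ε / 4 < ⨆ t : E, ‖f t‖ by
    change supNorm f - ε / 4 < supNorm f
    linarith)
  filter_upwards [hfg (ε / 4) (by positivity), hT.eventually_gt_atTop ‖t₀‖] with n hn hTn
  have hlow : ‖g n t₀‖ ≤ supNormBall (g n) (T n) :=
    le_ciSup (f := fun t : {t : E // ‖t‖ < T n} => ‖g n t‖)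
      (bddAbove_range_norm_of_forall_le (hg n) _) ⟨t₀, hTn⟩
  have hup : supNormBall (g n) (T n) ≤ supNorm f + ε / 4 := by
    have : Nonempty {t : E // ‖t‖ < T n} := ⟨⟨t₀, hTn⟩⟩
    refine ciSup_le fun t => ?_
    have h1 : ‖f t‖ ≤ supNorm f := le_ciSup (bddAbove_range_norm_of_forall_le hf id) (t : E)
    have h2 := hn t t.2
    have h3 := norm_sub_norm_le (g n t) (f t)
    linarith
  have h2 := hn t₀ hTn
  have h3 := norm_sub_norm_le (f t₀) (g n t₀)
  rw [norm_sub_rev] at h3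
  rw [Real.dist_eq, sub_zero, abs_abs, abs_lt]
  constructor <;> linarith

lemma norm_sub_mul_sub_sub_mul_le {a b c a' b' c' : ℂ} (hb : ‖b‖ ≤ 1) (hc' : ‖c'‖ ≤ 1) :
    ‖(a - b * c) - (a' - b' * c')‖ ≤ ‖a - a'‖ + ‖b - b'‖ + ‖c - c'‖ := by
  have h1 : (a - b * c) - (a' - b' * c') = (a - a') + -(b * (c - c')) + -((b - b') * c') := by ring
  have h2 : ‖b * (c - c')‖ ≤ ‖c - c'‖ := by
    rw [norm_mul]
    exact mul_le_of_le_one_left (norm_nonneg _) hb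
  have h3 : ‖(b - b') * c'‖ ≤ ‖b - b'‖ := by
    rw [norm_mul]
    exact mul_le_of_le_one_right (norm_nonneg _) hc'
  rw [h1]
  refine norm_add₃_le.trans ?_
  rw [norm_neg, norm_neg]
  linarith

lemma norm_sub_mul_le_two {a b c : ℂ} (ha : ‖a‖ ≤ 1) (hb : ‖b‖ ≤ 1) (hc : ‖c‖ ≤ 1) :
    ‖a - b * c‖ ≤ 2 := by
  have h : ‖b * c‖ ≤ 1 := by
    rw [norm_mul]
    exact mul_le_one₀ hb (norm_nonneg _) hc
  linarith [norm_sub_le a (b * c)]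

lemma aemeasurable_toLp_prodMk {F G Ω : Type*} [MeasurableSpace F] [MeasurableSpace G]
    [MeasurableSpace Ω] {P : Measure Ω} {X : Ω → F} {Y : Ω → G}
    (hX : AEMeasurable X P) (hY : AEMeasurable Y P) :
    AEMeasurable (fun ω => WithLp.toLp 2 (X ω, Y ω)) P :=
  (WithLp.measurable_toLp 2 (F × G)).comp_aemeasurable (hX.prodMk hY)

/-! ### Marginals as restrictions of the joint characteristic function. -/

section Marginals

variable {F G : Type*} [NormedAddCommGroup F] [InnerProductSpace ℝ F] [NormedAddCommGroup G]
  [InnerProductSpace ℝ G]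

lemma empCharFun_fst (x : ℕ → F) (y : ℕ → G) (n : ℕ) (s : F) :
    empCharFun x n s = empCharFun (fun j => WithLp.toLp 2 (x j, y j)) n (WithLp.toLp 2 (s, 0)) := by
  simp [empCharFun]

lemma empCharFun_snd (x : ℕ → F) (y : ℕ → G) (n : ℕ) (t : G) :
    empCharFun y n t = empCharFun (fun j => WithLp.toLp 2 (x j, y j)) n (WithLp.toLp 2 (0, t)) := by
  simp [empCharFun]

variable [MeasurableSpace F] [BorelSpace F] [SecondCountableTopology F] [MeasurableSpace G]
  [BorelSpace G] [SecondCountableTopology G] {Ω : Type*} [MeasurableSpace Ω] {P : Measure Ω}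
  {X : Ω → F} {Y : Ω → G}

lemma charFun_map_fst (hX : AEMeasurable X P) (hY : AEMeasurable Y P) (s : F) :
    charFun (P.map X) s
      = charFun (P.map fun ω => WithLp.toLp 2 (X ω, Y ω)) (WithLp.toLp 2 (s, 0)) := by
  rw [charFun_apply, charFun_apply, integral_map hX (Measurable.aestronglyMeasurable (by fun_prop)),
    integral_map (aemeasurable_toLp_prodMk hX hY) (Measurable.aestronglyMeasurable (by fun_prop))]
  simp

lemma charFun_map_snd (hX : AEMeasurable X P) (hY : AEMeasurable Y P) (t : G) :
    charFun (P.map Y) t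
      = charFun (P.map fun ω => WithLp.toLp 2 (X ω, Y ω)) (WithLp.toLp 2 (0, t)) := by
  rw [charFun_apply, charFun_apply, integral_map hY (Measurable.aestronglyMeasurable (by fun_prop)),
    integral_map (aemeasurable_toLp_prodMk hX hY) (Measurable.aestronglyMeasurable (by fun_prop))]
  simp

end Marginals

theorem corollary2 {Ω₀ Ω : Type*} [MeasurableSpace Ω₀] [MeasurableSpace Ω]
    (P : Measure Ω₀) [IsProbabilityMeasure P] (μ : Measure Ω) [IsProbabilityMeasure μ]
    (dX dY : ℕ)
    (X : Ω₀ → EuclideanSpace ℝ (Fin dX)) (Y : Ω₀ → EuclideanSpace ℝ (Fin dY))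
    (x : ℕ → Ω → EuclideanSpace ℝ (Fin dX)) (y : ℕ → Ω → EuclideanSpace ℝ (Fin dY))
    (hindep : iIndepFun (fun j ω => (x j ω, y j ω)) μ)
    (hident : ∀ j, IdentDistrib (fun ω => (x j ω, y j ω)) (fun ω => (X ω, Y ω)) μ P)
    (T : ℕ → ℝ) (hT : Tendsto T atTop atTop)
    (hlog : Tendsto (fun n : ℕ => Real.log (T n) / (n : ℝ)) atTop (𝓝 0)) :
    ∀ᵐ ω ∂μ, Tendsto
      (fun n : ℕ => |kacIM P X Y - supNormBall (empDelta (fun j => x j ω) (fun j => y j ω) n) (T n)|)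
      atTop (𝓝 0) := by
  -- Measurability of `X` and `Y` is part of the identity in distribution.
  have hX : AEMeasurable X P := measurable_fst.comp_aemeasurable (hident 0).aemeasurable_snd
  have hY : AEMeasurable Y P := measurable_snd.comp_aemeasurable (hident 0).aemeasurable_snd
  have hL : Measurable (WithLp.toLp 2 :
      EuclideanSpace ℝ (Fin dX) × EuclideanSpace ℝ (Fin dY) → PairSpace dX dY) :=
    WithLp.measurable_toLp 2 _
  set Z : ℕ → Ω → PairSpace dX dY := fun j ω => WithLp.toLp 2 (x j ω, y j ω) with hZdef
  set ν : Measure (PairSpace dX dY) := P.map fun ω => WithLp.toLp 2 (X ω, Y ω) with hν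
  have hZ : ∀ j, IdentDistrib (Z j) (fun ω => (WithLp.toLp 2 (X ω, Y ω) : PairSpace dX dY)) μ P :=
    fun j => (hident j).comp hL
  have : IsProbabilityMeasure ν := Measure.isProbabilityMeasure_map (hZ 0).aemeasurable_snd
  have hZind : iIndepFun Z μ := hindep.comp (fun _ => WithLp.toLp 2) (fun _ => hL)
  filter_upwards [ae_forall_eventually_forall_mem_ball_norm_empCharFun_sub_charFun_lt hZind
    (fun j => (hZ j).aemeasurable_fst) (fun j => (hZ j).map_eq) hT hlog] with ω hω
  have hemp : ∀ n (γ : PairSpace dX dY), empDelta (fun j => x j ω) (fun j => y j ω) n γ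
      = empCharFun (fun j => Z j ω) n γ
        - empCharFun (fun j => Z j ω) n (WithLp.toLp 2 (γ.fst, 0))
          * empCharFun (fun j => Z j ω) n (WithLp.toLp 2 (0, γ.snd)) := fun n γ => by
    rw [empDelta, empCharFun_fst (fun j => x j ω) (fun j => y j ω),
      empCharFun_snd (fun j => x j ω) (fun j => y j ω)]
  have hcf : ∀ γ : PairSpace dX dY, cfDelta P X Y γ
      = charFun ν γ - charFun ν (WithLp.toLp 2 (γ.fst, 0))
          * charFun ν (WithLp.toLp 2 (0, γ.snd)) := fun γ => by
    rw [cfDelta, charFun_map_fst hX hY, charFun_map_snd hX hY]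
  refine tendsto_abs_supNorm_sub_supNormBall (C := 2) (fun γ => ?_) (fun n γ => ?_) hT
    fun ε hε => ?_
  · rw [hcf]
    exact norm_sub_mul_le_two (norm_charFun_le_one _) (norm_charFun_le_one _)
      (norm_charFun_le_one _)
  · rw [hemp]
    exact norm_sub_mul_le_two (norm_empCharFun_le_one _ _ _) (norm_empCharFun_le_one _ _ _)
      (norm_empCharFun_le_one _ _ _)
  · filter_upwards [hω (ε / 3) (by positivity)] with n hn γ hγ
    rw [hemp, hcf]
    refine (norm_sub_mul_sub_sub_mul_le (norm_empCharFun_le_one _ _ _)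
      (norm_charFun_le_one _)).trans_lt ?_
    -- Coordinate projections do not increase the norm, so all three frequencies lie in the ball of
    -- radius `T n`, and each contributes `ε / 3`.
    have hfst : ‖(WithLp.toLp 2 (γ.fst, 0) : PairSpace dX dY)‖ ≤ ‖γ‖ := by
      rw [WithLp.prod_norm_eq_of_L2, WithLp.prod_norm_eq_of_L2 γ]
      refine Real.sqrt_le_sqrt ?_
      simp
    have hsnd : ‖(WithLp.toLp 2 (0, γ.snd) : PairSpace dX dY)‖ ≤ ‖γ‖ := by
      rw [WithLp.prod_norm_eq_of_L2, WithLp.prod_norm_eq_of_L2 γ]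
      refine Real.sqrt_le_sqrt ?_
      simp
    linarith [hn γ hγ, hn _ (hfst.trans_lt hγ), hn _ (hsnd.trans_lt hγ)]
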